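/- **Setting.** Graphs have no loops or multiple edges, and every edge $\{x,y\}$ is regarded as a pair of oriented edges. Let $X$ be an infinite connected graph and let $\Sigma$ be a finite alphabet. Let $\ell$ be a labelling of the oriented edges of $X$ by elements of $\Sigma$ that is deterministic: different oriented edges with the same initial vertex, or with the same terminal vertex, have distinct labels (so $X$ is locally finite). Let $\Gamma=\mathrm{AUT}(X,\ell)$ be the group of label-preserving automorphisms of $X$, and assume that $\Gamma$ acts quasi-transitively, i.e. has finitely many orbits on the vertices. For a vertex $o$, let $L_{\mathrm{SAW},o}\subseteq\Sigma^*$ be the set of all words $\ell(e_1)\cdots\ell(e_n)$, $n\ge 0$, where $[e_1,\dots,e_n]$ is a self-avoiding walk in $X$ starting at $o$. **Ends.** A ray is a sequence of distinct vertices, consecutive ones being adjacent. Two rays of a graph $S$ are equivalent if for every finite vertex set $K$ all but finitely many vertices of both lie in the same component of $S\setminus K$; an end is an equivalence class of rays. $C(K,\omega)$ is the component of $S\setminus K$ containing all but finitely many vertices of each ray in $\omega$. A defining sequence of $\omega$ is a sequence $(K_n)_{n\ge0}$ of finite vertex sets with $C(K_n,\omega)\supseteq K_{n+1}\cup C(K_{n+1},\omega)$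 for all $n$. **Strips.** A strip is a locally finite, connected graph with precisely two ends whose automorphism group acts with finitely many orbits on its vertices. For $\tau\in\mathrm{AUT}(S)$, a strip $S$ with ends $\omega^+\ne\omega^-$ is a $\tau$-strip of size $m$ if there is a set $K$ of $m$ vertices of $S$ such that - $(\tau^nK)_{n\ge0}$ and $(\tau^{-n}K)_{n\ge0}$ are defining sequences of $\omega^+$ and $\omega^-$, respectively; - $S$ contains $m$ pairwise disjoint $\tau$-invariant double rays, each meeting every $\tau^nK$ ($n\in\mathbb Z$) in precisely one vertex; - the subgraph of $S$ spanned by $\bigl(K\cup C(K,\omega^+)\bigr)\setminus C(\tau K,\omega^+)$ is finite and connected. For $\tau\in\mathrm{AUT}(X)$, the graph $X$ contains a $\tau$-strip of size $m$ if $\tau$ restricts to an automorphism of some subgraph $S$ of $X$ for which $S$ is a $\tau$-strip of size $m$. **Proposition.** If $X$ contains a $\tau$-strip of size $3$ for some $\tau\in\Gamma$, then for every vertex $o$ of $X$ the language $L_{\mathrm{SAW},o}$ is not context-free. -/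

import Mathlib

namespace SAWLang

section Ends

variable {V : Type*} (G : SimpleGraph V)

/-- A ray of `G`: a sequence of distinct vertices, consecutive ones being adjacent. -/
structure Ray where
  vert : ℕ → V
  inj : Function.Injective vert
  adj : ∀ n, G.Adj (vert n) (vert (n + 1))

variable {G}

/-- All but finitely many vertices of the ray `r` lie in the component `C` of `G` minus `K`. -/
def Ray.EndsUpIn (r : Ray G) {K : Set V} (C : G.ComponentCompl K) : Prop :=
  ∀ᶠ n in Filter.atTop, r.vert n ∈ C

/-- Two rays are equivalent if, for every finite set `K` of vertices, both end up in the same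
component of `G` minus `K`. -/
def Ray.Equivalent (r s : Ray G) : Prop :=
  ∀ K : Set V, K.Finite → ∃ C : G.ComponentCompl K, r.EndsUpIn C ∧ s.EndsUpIn C

theorem Ray.equivalent_refl (r : Ray G) : r.Equivalent r := by
  intro K hK
  have h1 : ∀ᶠ n in Filter.atTop, r.vert n ∉ K := by
    have h2 : (r.vert ⁻¹' K).Finite := hK.preimage r.inj.injOn
    have h3 := h2.compl_mem_cofinite
    rw [Nat.cofinite_eq_atTop] at h3
    exact h3
  obtain ⟨N, hN⟩ := Filter.eventually_atTop.1 h1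
  have key : ∀ n, N ≤ n → r.vert n ∈ G.componentComplMk (hN N le_rfl) := by
    intro n hn
    induction n, hn using Nat.le_induction with
    | base => exact SimpleGraph.componentComplMk_mem G _
    | succ n hn ih =>
      obtain ⟨h, hC⟩ := ih
      exact ⟨hN _ (Nat.le_succ_of_le hn), by
        rw [← hC]
        exact (SimpleGraph.componentComplMk_eq_of_adj G h _ (r.adj n)).symm⟩
  have h4 : r.EndsUpIn (G.componentComplMk (hN N le_rfl)) :=
    Filter.eventually_atTop.2 ⟨N, key⟩
  exact ⟨_, h4, h4⟩

/-- A ray ends up in at most one component. -/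
theorem Ray.EndsUpIn.unique {r : Ray G} {K : Set V} {C D : G.ComponentCompl K}
    (hC : r.EndsUpIn C) (hD : r.EndsUpIn D) : C = D := by
  obtain ⟨n, ⟨_, h1⟩, ⟨_, h2⟩⟩ := (Filter.Eventually.and hC hD).exists
  exact h1.symm.trans h2

variable (G)

instance raySetoid : Setoid (Ray G) where
  r := Ray.Equivalent
  iseqv :=
    { refl := Ray.equivalent_refl
      symm := fun h K hK => by
        obtain ⟨C, h1, h2⟩ := h K hK
        exact ⟨C, h2, h1⟩
      trans := fun h h' K hK => by
        obtain ⟨C, h1, h2⟩ := h K hK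
        obtain ⟨D, h3, h4⟩ := h' K hK
        obtain rfl := h2.unique h3
        exact ⟨C, h1, h4⟩ }

/-- The ends of `G`: equivalence classes of rays. -/
def EndSpace : Type _ := Quotient (raySetoid G)

/-- The end represented by a ray. -/
def Ray.toEnd {G : SimpleGraph V} (r : Ray G) : EndSpace G := Quotient.mk (raySetoid G) r

/-- The vertex set of the component `C(K, ω)` of `G` minus `K` in which all rays representing `ω`
end up (for finite `K` there is exactly one such component). -/
def endComponent (K : Set V) (ω : EndSpace G) : Set V :=
  {v | ∃ C : G.ComponentCompl K, (∀ r : Ray G, r.toEnd = ω → r.EndsUpIn C) ∧ v ∈ C}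

/-- Defining sequences `(K n)` of an end `ω`: all `K n` are finite and
`C(K n, ω) ⊇ K (n + 1) ∪ C(K (n + 1), ω)`. -/
def IsDefiningSequence (K : ℕ → Set V) (ω : EndSpace G) : Prop :=
  (∀ n, (K n).Finite) ∧
    ∀ n, K (n + 1) ∪ endComponent G (K (n + 1)) ω ⊆ endComponent G (K n) ω

variable {G}

/-- A double ray: a subgraph spanned by a two-sided infinite sequence of distinct vertices, whose
edges are those between consecutive vertices of the sequence. -/
def IsDoubleRay (R : G.Subgraph) : Prop :=
  ∃ ρ : ℤ → V, Function.Injective ρ ∧ R.verts = Set.range ρ ∧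
    ∀ x y, R.Adj x y ↔ ∃ i, s(x, y) = s(ρ i, ρ (i + 1))

end Ends

section Strips

variable {V : Type*}

/-- The group `Γ` of automorphisms of `G` has only finitely many orbits on the vertices. -/
def ActsQuasiTransitively (G : SimpleGraph V) (Γ : Subgroup (G ≃g G)) : Prop :=
  ∃ F : Set V, F.Finite ∧ ∀ v, ∃ u ∈ F, ∃ γ ∈ Γ, γ u = v

/-- A strip: a locally finite, connected, quasi-transitive graph with precisely two ends. -/
structure IsStrip (G : SimpleGraph V) : Prop where
  locallyFinite : ∀ v, (G.neighborSet v).Finite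
  connected : G.Connected
  quasiTransitive : ActsQuasiTransitively G ⊤
  two_ends : Nat.card (EndSpace G) = 2

/-- `G` is a `τ`-strip of size `m`. The ends of `G` are `ωp` (`ω⁺`) and `ωm` (`ω⁻`). -/
def IsTauStrip (G : SimpleGraph V) (τ : G ≃g G) (m : ℕ) : Prop :=
  IsStrip G ∧
  ∃ ωp ωm : EndSpace G, ωp ≠ ωm ∧
  ∃ K : Finset V, K.card = m ∧
    IsDefiningSequence G (fun n : ℕ => (τ ^ n) '' (K : Set V)) ωp ∧
    IsDefiningSequence G (fun n : ℕ => (τ⁻¹ ^ n) '' (K : Set V)) ωm ∧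
    -- `m` disjoint `τ`-invariant double rays, meeting each `τ ^ n K` in precisely one vertex
    (∃ R : Fin m → G.Subgraph,
      (∀ i, IsDoubleRay (R i)) ∧
      (∀ i j, i ≠ j → Disjoint (R i).verts (R j).verts) ∧
      (∀ i, (R i).map τ.toHom = R i) ∧
      ∀ i, ∀ n : ℤ, ∃! v, v ∈ (R i).verts ∩ (τ ^ n) '' (K : Set V)) ∧
    -- the subgraph spanned by `K ∪ C(K, ω⁺) \ C(τ K, ω⁺)` is finite and connected
    (((K : Set V) ∪ endComponent G K ωp) \ endComponent G (τ '' (K : Set V)) ωp).Finite ∧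
    (G.induce
      (((K : Set V) ∪ endComponent G K ωp) \ endComponent G (τ '' (K : Set V)) ωp)).Connected

/-- The graph `X` contains a `τ`-strip of size `m`, where `τ` is an automorphism of `X`: there is
a subgraph `S` such that `τ` restricts to an automorphism `σ` of `S` for which `S` is a `σ`-strip
of size `m`. -/
def ContainsTauStrip (X : SimpleGraph V) (τ : X ≃g X) (m : ℕ) : Prop :=
  ∃ (S : X.Subgraph) (σ : S.coe ≃g S.coe),
    (∀ v : S.verts, (σ v : V) = τ v) ∧ IsTauStrip S.coe σ m

end Strips

section Labels

variable {V A : Type*} (X : SimpleGraph V) (ℓ : X.Dart → A)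

/-- Different oriented edges with the same initial or the same terminal vertex have distinct
labels. -/
def IsDeterministic : Prop :=
  ∀ d e : X.Dart, d ≠ e → (d.fst = e.fst ∨ d.snd = e.snd) → ℓ d ≠ ℓ e

/-- The group of all automorphisms of `X` that preserve the labels of the oriented edges. -/
def labelAut : Subgroup (X ≃g X) where
  carrier := {γ | ∀ d : X.Dart, ℓ (γ.toHom.mapDart d) = ℓ d}
  one_mem' := fun _ => rfl
  mul_mem' := fun {γ δ} hγ hδ d => (hγ (δ.toHom.mapDart d)).trans (hδ d)
  inv_mem' := fun {γ} hγ d => by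
    rw [← hγ ((γ⁻¹ : X ≃g X).toHom.mapDart d)]
    congr 1
    ext
    · exact RelIso.apply_inv_self γ d.fst
    · exact RelIso.apply_inv_self γ d.snd

/-- The language of self-avoiding walks: the words read along the paths of `X` that start at `o`
(the empty path included). -/
def sawLanguage (o : V) : Language A :=
  {w | ∃ (v : V) (p : X.Walk o v), p.IsPath ∧ w = p.darts.map ℓ}

end Labels

end SAWLang

/-! A strip of size 3 supplies three disjoint double rays `I`, `J`, `H` (lanes) on which `τ` acts as
a translation. Consider the walk from `o` that runs `k` periods forward on `I`, crosses to `J`, runs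
`l` periods back, crosses to `I` by the reversed link, passes on to `H`, runs `m` periods forward
and finally returns to `J`. For `k < l < m` with large gaps it is self-avoiding: the second crossing
lies behind the start on `I`, the return to `J` ahead of the first crossing. If `l` is much smaller
than `k`, the second crossing hits the used part of `I`; if `m` is much smaller than `l`, the last
link ends on the used part of `J`. Since the labelling is deterministic, a word determines its walk
from `o`, so membership of `P aᵏ Q bˡ R cᵐ U` is governed by these inequalities
(`not_isContextFree_of_linked_lanes`).

A grammar cannot enforce both comparisons. In derivations of ever larger words, choose subtrees
whose yields contain many, but not all, of the `b` periods (`ContextFreeGrammar.Gen.exists_node`).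
As some `b` lies outside, such a yield counts no `a` or no `c`. By pigeonhole, two of these subtrees
of very different size share the nonterminal, the missing letter and the automaton states at both
ends. Interchanging them changes `l` drastically but leaves `k` (or `m`) alone, which breaks one of
the inequalities (`Language.not_isContextFree_of_weightedRun`). The automaton states handle yields
that begin or end inside a factor. -/

/-! ### Derivation forests of context-free grammars -/

namespace ContextFreeGrammar

variable {T : Type*} {g : ContextFreeGrammar T}

/-- `g.Gen α x`: the word `x` is the yield of a derivation forest of `g` with roots `α`. -/
inductive Gen (g : ContextFreeGrammar T) : List (Symbol T g.NT) → List T → Prop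
  | nil : Gen g [] []
  | terminal (t : T) {α : List (Symbol T g.NT)} {x : List T} :
      Gen g α x → Gen g (.terminal t :: α) (t :: x)
  | nonterminal (r : ContextFreeRule T g.NT) {α : List (Symbol T g.NT)} {x y : List T} :
      r ∈ g.rules → Gen g r.output x → Gen g α y → Gen g (.nonterminal r.input :: α) (x ++ y)

theorem Gen.append {α β : List (Symbol T g.NT)} {x y : List T}
    (hα : g.Gen α x) (hβ : g.Gen β y) : g.Gen (α ++ β) (x ++ y) := by
  induction hα with
  | nil => exact hβ
  | terminal t _ ih => exact .terminal t ih
  | nonterminal r hr h _ _ ih =>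
    rw [List.append_assoc]
    exact .nonterminal r hr h ih

theorem Gen.exists_of_append {α β : List (Symbol T g.NT)} {x : List T}
    (h : g.Gen (α ++ β) x) : ∃ y z, x = y ++ z ∧ g.Gen α y ∧ g.Gen β z := by
  induction α generalizing x with
  | nil => exact ⟨[], x, rfl, .nil, h⟩
  | cons s α ih =>
    cases h with
    | terminal t h =>
      obtain ⟨y, z, rfl, h1, h2⟩ := ih h
      exact ⟨t :: y, z, rfl, .terminal t h1, h2⟩
    | nonterminal r hr h h' =>
      obtain ⟨y, z, rfl, h1, h2⟩ := ih h'
      exact ⟨_, z, (List.append_assoc ..).symm, .nonterminal r hr h h1, h2⟩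

theorem gen_terminals (x : List T) : g.Gen (x.map .terminal) x := by
  induction x with
  | nil => exact .nil
  | cons t x ih => exact .terminal t ih

theorem Gen.of_derives {α : List (Symbol T g.NT)} {x : List T}
    (h : g.Derives α (x.map .terminal)) : g.Gen α x := by
  induction h using Relation.ReflTransGen.head_induction_on with
  | refl => exact gen_terminals x
  | head h _ ih =>
    obtain ⟨r, hr, h⟩ := h
    obtain ⟨p, q, rfl, rfl⟩ := h.exists_parts
    obtain ⟨y, z, rfl, h1, h2⟩ := ih.exists_of_append
    obtain ⟨y, y', rfl, h1, h3⟩ := h1.exists_of_append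
    have := Gen.nonterminal r hr h3 .nil
    rw [List.append_nil] at this
    exact (h1.append this).append h2

theorem Gen.derives {α : List (Symbol T g.NT)} {x : List T}
    (h : g.Gen α x) : g.Derives α (x.map .terminal) := by
  induction h with
  | nil => exact .refl _
  | terminal t _ ih => exact ih.append_left [.terminal t]
  | @nonterminal r α x y hr _ _ ih ih' =>
    have h1 : g.Produces [.nonterminal r.input] r.output := ⟨r, hr, .input_output⟩
    have h2 := (h1.single.trans ih).append_right α
    rw [List.map_append]
    exact h2.trans (ih'.append_left _)

/-- Gives access to the nodes of a derivation tree by structural induction, which a sequence of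
rewriting steps hides. -/
theorem mem_language_iff_gen {x : List T} : x ∈ g.language ↔ g.Gen [.nonterminal g.initial] x :=
  ⟨Gen.of_derives, Gen.derives⟩

end ContextFreeGrammar

/-! ### Weighted automata and the interchange argument -/

/-- `WeightedRun step p x c q`: the weighted automaton with transitions `step` has a run from `p`
to `q` reading the word `x`, of total weight `c`. -/
inductive WeightedRun {Q T M : Type*} [AddMonoid M] (step : Q → T → M → Q → Prop) :
    Q → List T → M → Q → Prop
  | nil (p : Q) : WeightedRun step p [] 0 p
  | cons {p q r : Q} {t : T} {x : List T} {c d : M} :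
      step p t c q → WeightedRun step q x d r → WeightedRun step p (t :: x) (c + d) r

namespace WeightedRun

variable {Q T M : Type*} [AddMonoid M] {step : Q → T → M → Q → Prop}

theorem append {p q r : Q} {x y : List T} {c d : M} (h : WeightedRun step p x c q)
    (h' : WeightedRun step q y d r) : WeightedRun step p (x ++ y) (c + d) r := by
  induction h with
  | nil => simpa using h'
  | cons hs _ ih =>
    rw [add_assoc]
    exact .cons hs (ih h')

theorem exists_of_append {p r : Q} {x y : List T} {e : M}
    (h : WeightedRun step p (x ++ y) e r) :
    ∃ q c d, e = c + d ∧ WeightedRun step p x c q ∧ WeightedRun step q y d r := by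
  induction x generalizing p e with
  | nil => exact ⟨p, 0, e, (zero_add e).symm, .nil p, h⟩
  | cons t x ih =>
    cases h with
    | cons hs h =>
      obtain ⟨q, c, d, rfl, h1, h2⟩ := ih h
      exact ⟨q, _, d, (add_assoc ..).symm, .cons hs h1, h2⟩

/-- The pigeonhole argument needs finitely many states, while `Q` itself may be infinite. -/
theorem mem_of_closed {F : Set Q} (hF : ∀ p t c q, step p t c q → p ∈ F → q ∈ F)
    {p q : Q} {x : List T} {c : M} (h : WeightedRun step p x c q) (hp : p ∈ F) : q ∈ F := by
  induction h with
  | nil => exact hp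
  | cons hs _ ih => exact ih (hF _ _ _ _ hs hp)

end WeightedRun

/-- In a derivation forest of large weight, there is a node whose weight lies in a prescribed
range. -/
theorem ContextFreeGrammar.Gen.exists_node {T Q ι : Type*} {g : ContextFreeGrammar T}
    {step : Q → T → (ι → ℕ) → Q → Prop} (i : ι) (hstep : ∀ p t c q, step p t c q → c i ≤ 1)
    {θ n : ℕ} (hθ : 1 ≤ θ) (hn : ∀ r ∈ g.rules, θ * r.output.length < n)
    {α : List (Symbol T g.NT)} {x : List T} (h : g.Gen α x) {p q : Q} {c : ι → ℕ}
    (hrun : WeightedRun step p x c q) (hc : θ * α.length < c i) :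
    ∃ r ∈ g.rules, ∃ (p' q' : Q) (u y v : List T) (c₁ d c₂ : ι → ℕ),
      x = u ++ y ++ v ∧ c = c₁ + d + c₂ ∧ WeightedRun step p u c₁ p' ∧
      WeightedRun step p' y d q' ∧ WeightedRun step q' v c₂ q ∧ θ ≤ d i ∧ d i < n ∧
      g.Gen [.nonterminal r.input] y ∧
      ∀ z, g.Gen [.nonterminal r.input] z → g.Gen α (u ++ z ++ v) := by
  induction h generalizing p q c with
  | nil => cases hrun; simp at hc
  | terminal t h ih =>
    cases hrun with
    | @cons _ p₁ _ _ _ c d hs hrun =>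
      have h1 := hstep _ _ _ _ hs
      obtain ⟨r, hr, p', q', u, y, v, c₁, e, c₂, rfl, rfl, h2, h3, h4, h5, h6, h7, h8⟩ := ih hrun (by
        simp only [List.length_cons, Pi.add_apply, mul_add, mul_one] at hc
        omega)
      exact ⟨r, hr, p', q', t :: u, y, v, c + c₁, e, c₂, rfl, by simp only [add_assoc],
        .cons hs h2, h3, h4, h5, h6, h7, fun z hz => .terminal t (h8 z hz)⟩
  -- If the first tree has weight in the range, its root is the node. If it is too heavy, its
  -- children inherit the hypothesis, because `θ` times their number is below `n`. If it is too
  -- light, it can be discarded.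
  | @nonterminal r α x y hr h h' ih ih' =>
    obtain ⟨p₁, c₀, c₃, rfl, hx, hy⟩ := hrun.exists_of_append
    by_cases h1 : θ ≤ c₀ i
    · by_cases h2 : c₀ i < n
      · refine ⟨r, hr, p, p₁, [], x, y, 0, c₀, c₃, rfl, by simp, .nil p, hx, hy, h1, h2, ?_, ?_⟩
        · have := ContextFreeGrammar.Gen.nonterminal r hr h .nil
          rwa [List.append_nil] at this
        · intro z hz
          exact hz.append h'
      · obtain ⟨r', hr', p', q', u, w, v, c₁, e, c₂, rfl, rfl, h2, h3, h4, h5, h6, h7, h8⟩ :=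
          ih hx ((hn r hr).trans_le (not_lt.1 h2))
        refine ⟨r', hr', p', q', u, w, v ++ y, c₁, e, c₂ + c₃, by simp, by simp only [add_assoc],
          h2, h3, h4.append hy, h5, h6, h7, fun z hz => ?_⟩
        have := ContextFreeGrammar.Gen.nonterminal r hr (h8 z hz) h'
        rwa [List.append_assoc] at this
    · obtain ⟨r', hr', p', q', u, w, v, c₁, e, c₂, rfl, rfl, h2, h3, h4, h5, h6, h7, h8⟩ :=
          ih' hy (by
            simp only [List.length_cons, Pi.add_apply, mul_add, mul_one] at hc
            omega)
      refine ⟨r', hr', p', q', x ++ u, w, v, c₀ + c₁, e, c₂, by simp, by simp only [add_assoc],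
          hx.append h2, h3, h4, h5, h6, h7, fun z hz => ?_⟩
      have := ContextFreeGrammar.Gen.nonterminal r hr h (h8 z hz)
      simpa using this

/-- An interchange criterion: `L` is not context-free if, among the words accepted by a weighted
automaton with weights `(a, b, c)`, it contains words with `a < b < c` of all sizes, but none for
which `b` is much smaller than `a`, or `c` is much smaller than `b`. -/
theorem Language.not_isContextFree_of_weightedRun {T Q : Type*} {L : Language T}
    {step : Q → T → (ℕ → ℕ) → Q → Prop} {F : Set Q} (hFfin : F.Finite)
    (hF : ∀ p t c q, step p t c q → p ∈ F → q ∈ F) {start final : Q} (hstart : start ∈ F)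
    (hstep : ∀ p t c q, step p t c q → c 1 ≤ 1)
    (hleft : ∀ {p q r x y c d}, WeightedRun step p x c q → WeightedRun step q y d r →
      0 < c 1 → d 0 = 0)
    (hright : ∀ {p q r x y c d}, WeightedRun step p x c q → WeightedRun step q y d r →
      0 < d 1 → c 2 = 0)
    (C : ℕ)
    (hmem : ∀ N, C ≤ N → ∃ x ∈ L, ∃ c, WeightedRun step start x c final ∧
      c 0 = N ∧ c 1 = N + C ∧ c 2 = N + 2 * C)
    (hba : ∀ x c, WeightedRun step start x c final → C ≤ c 1 → c 1 + C ≤ c 0 → x ∉ L)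
    (hcb : ∀ x c, WeightedRun step start x c final → C ≤ c 2 → c 2 + C ≤ c 1 → x ∉ L) :
    ¬ L.IsContextFree := by
  rintro ⟨g, rfl⟩
  obtain ⟨K, hK⟩ : ∃ K, ∀ r ∈ g.rules, r.output.length ≤ K + 1 :=
    ⟨g.rules.sup fun r => r.output.length, fun r hr =>
      (Finset.le_sup (f := fun r : ContextFreeRule T g.NT => r.output.length) hr).trans
        (Nat.le_succ _)⟩
  have key : ∀ s : ℕ, ∃ (r : g.rules) (p q : F) (b : Bool) (N : ℕ) (u y v : List T)
      (c₁ d c₂ : ℕ → ℕ), C ≤ N ∧ WeightedRun step start u c₁ p ∧ WeightedRun step p y d q ∧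
      WeightedRun step q v c₂ final ∧ s + C ≤ d 1 ∧ (c₁ + d + c₂) 0 = N ∧
      (c₁ + d + c₂) 1 = N + C ∧ (c₁ + d + c₂) 2 = N + 2 * C ∧
      (b = true → d 0 = 0) ∧ (b = false → d 2 = 0) ∧
      g.Gen [.nonterminal r.1.input] y ∧
      ∀ z, g.Gen [.nonterminal r.1.input] z → u ++ z ++ v ∈ g.language := by
    intro s
    -- With `θ = s + C + 1`, the factor `K + 2` makes the `b`-weight exceed `θ` times any rule
    -- length, and also `θ` itself, as the single root requires.
    obtain ⟨x, hx, c, hrun, h0, h1, h2⟩ := hmem ((s + C + 1) * (K + 2) + C) (by omega)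
    rw [ContextFreeGrammar.mem_language_iff_gen] at hx
    -- The upper bound is the total weight, so the node found leaves some `b` outside, to its left
    -- or to its right.
    have hn : ∀ r ∈ g.rules, (s + C + 1) * r.output.length < c 1 := by
      intro r hr
      have := Nat.mul_le_mul_left (s + C + 1) (hK r hr)
      rw [h1]
      simp only [mul_add] at this ⊢
      omega
    obtain ⟨r, hr, p, q, u, y, v, c₁, d, c₂, rfl, rfl, h3, h4, h5, h6, h7, h8, h9⟩ :=
      hx.exists_node 1 hstep (θ := s + C + 1) (by omega) hn hrun (by
        rw [h1, mul_add, List.length_singleton]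
        omega)
    have hp : p ∈ F := h3.mem_of_closed hF hstart
    have hq : q ∈ F := h4.mem_of_closed hF hp
    have hb : ∃ b : Bool, (b = true → d 0 = 0) ∧ (b = false → d 2 = 0) := by
      simp only [Pi.add_apply] at h7
      rcases Nat.eq_zero_or_pos (c₁ 1) with h | h
      · exact ⟨false, nofun, fun _ => hright h4 h5 (by omega)⟩
      · exact ⟨true, fun _ => hleft h3 h4 h, nofun⟩
    obtain ⟨b, hb⟩ := hb
    exact ⟨⟨r, hr⟩, ⟨p, hp⟩, ⟨q, hq⟩, b, _, u, y, v, c₁, d, c₂, by omega, h3, h4, h5, by omega,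
      h0, h1, h2, hb.1, hb.2, h8, fun z hz => ContextFreeGrammar.mem_language_iff_gen.2 (h9 z hz)⟩
  choose r p q b N u y v c₁ d c₂ hN hu hy hv hd h0 h1 h2 hbt hbf hgen hswap using key
  have := hFfin.to_subtype
  obtain ⟨⟨r₀, p₀, q₀, b₀⟩, hinf⟩ :=
    Finite.exists_infinite_fiber fun s => (r s, p s, q s, b s)
  rw [Set.infinite_coe_iff] at hinf
  obtain ⟨s, hs⟩ := hinf.nonempty
  -- Then the subtree for `s'` outweighs the one for `s` by more than `3 * C`.
  obtain ⟨s', hs', hlt⟩ := hinf.exists_gt (d s 1 + 2 * C)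
  simp only [Set.mem_preimage, Set.mem_singleton_iff, Prod.mk.injEq] at hs hs'
  obtain ⟨rfl, rfl, rfl, rfl⟩ := hs
  obtain ⟨hr, hp, hq, hb⟩ := hs'
  have e0 := h0 s; have e1 := h1 s; have e2 := h2 s; have e3 := hd s
  have e0' := h0 s'; have e1' := h1 s'; have e2' := h2 s'; have e3' := hd s'
  have e4 := hN s; have e4' := hN s'
  have hus := hu s; have hvs := hv s; have hys := hy s
  have hus' := hu s'; have hvs' := hv s'; have hys' := hy s'
  rw [hp] at hus' hys'
  rw [hq] at hvs' hys'
  have hg' := hgen s'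
  rw [hr] at hg'
  simp only [Pi.add_apply] at e0 e1 e2 e0' e1' e2'
  cases hbs : b s with
  | true =>
    have f := hbt s hbs
    have f' := hbt s' (hb.trans hbs)
    -- Neither yield counts an `a`: the small yield in the large context lowers only `b` relative to
    -- `a`.
    refine hba _ _ ((hus'.append hys).append hvs') ?_ ?_
      (hswap s' _ (by rw [hr]; exact hgen s)) <;> simp only [Pi.add_apply] <;> omega
  | false =>
    have f := hbf s hbs
    have f' := hbf s' (hb.trans hbs)
    -- Neither yield counts a `c`: the large yield in the small context raises `b` above `c`.
    refine hcb _ _ ((hus.append hys').append hvs) ?_ ?_ (hswap s _ hg') <;>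
      simp only [Pi.add_apply] <;> omega

/-! ### Block words and their automaton -/

/-- The word `w₀ ^ n₀ v₀ w₁ ^ n₁ v₁ ⋯` with `m` pairs of factors, starting from index `j`. -/
def blockWord {T : Type*} (w v : ℕ → List T) (n : ℕ → ℕ) : ℕ → ℕ → List T
  | 0, _ => []
  | m + 1, j => (List.replicate (n j) (w j)).flatten ++ v j ++ blockWord w v n m (j + 1)

theorem blockWord_congr {T : Type*} (w v : ℕ → List T) {n n' : ℕ → ℕ} (m j : ℕ)
    (h : ∀ i, j ≤ i → n i = n' i) : blockWord w v n m j = blockWord w v n' m j := by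
  induction m generalizing j with
  | zero => rfl
  | succ m ih =>
    rw [blockWord, blockWord, h j le_rfl, ih (j + 1) fun i hi => h i (by omega)]

/-- The transitions of an automaton reading the words `blockWord w v n m 0`. A state consists of the
rest of the factor that is currently read and the index of that factor; the weight counts how often
the factors `w j` are read. -/
inductive BlockStep {T : Type*} (w v : ℕ → List T) :
    List T × ℕ → T → (ℕ → ℕ) → List T × ℕ → Prop
  | read (t : T) (x : List T) (j : ℕ) : BlockStep w v (t :: x, j) t 0 (x, j)
  | loop (t : T) (x : List T) (j : ℕ) :
      w j = t :: x → BlockStep w v ([], j) t (Pi.single j 1) (x, j)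
  | exit (t : T) (x : List T) (j : ℕ) : v j = t :: x → BlockStep w v ([], j) t 0 (x, j + 1)

section BlockStep

variable {T : Type*} {w v : ℕ → List T}

theorem blockStep_weight_le {p q : List T × ℕ} {t : T} {c : ℕ → ℕ} (h : BlockStep w v p t c q)
    (i : ℕ) : c i ≤ 1 := by
  cases h with
  | loop t x j => by_cases hij : i = j <;> simp [hij]
  | _ => simp

/-- The index never decreases, and `w i` is counted only at index `i`; this fixes the order of the
blocks. -/
theorem blockRun_mono {p q : List T × ℕ} {x : List T} {c : ℕ → ℕ}
    (h : WeightedRun (BlockStep w v) p x c q) :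
    p.2 ≤ q.2 ∧ ∀ i, 0 < c i → p.2 ≤ i ∧ i ≤ q.2 := by
  induction h with
  | nil => simp
  | @cons p q r t x c d hs _ ih =>
    refine ⟨?_, fun i hi => ?_⟩
    · cases hs <;> simp_all <;> omega
    · rw [Pi.add_apply] at hi
      rcases Nat.eq_zero_or_pos (d i) with h0 | h0
      · rw [h0, add_zero] at hi
        cases hs with
        | loop t x j hj =>
          obtain rfl : i = j := by
            by_contra hij
            simp [hij] at hi
          exact ⟨le_rfl, ih.1⟩
        | _ => simp at hi
      · obtain ⟨h1, h2⟩ := ih.2 i h0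
        refine ⟨?_, h2⟩
        cases hs <;> simp only at h1 ⊢ <;> omega

theorem blockRun_read (x y : List T) (j : ℕ) :
    WeightedRun (BlockStep w v) (x ++ y, j) x 0 (y, j) := by
  induction x with
  | nil => exact .nil _
  | cons t x ih => simpa using WeightedRun.cons (.read t (x ++ y) j) ih

theorem blockRun_loop {j : ℕ} (hj : w j ≠ []) (n : ℕ) :
    WeightedRun (BlockStep w v) ([], j) (List.replicate n (w j)).flatten (Pi.single j n)
      ([], j) := by
  induction n with
  | zero => simpa using WeightedRun.nil _
  | succ n ih =>
    obtain ⟨t, x, hx⟩ := List.exists_cons_of_ne_nil hj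
    have h1 := WeightedRun.cons (BlockStep.loop (v := v) t x j hx) (by
      simpa using blockRun_read (w := w) (v := v) x [] j)
    have h2 := h1.append ih
    rw [← hx, add_zero, ← Pi.single_add, add_comm] at h2
    simpa [List.replicate_succ] using h2

theorem blockRun_exit {j : ℕ} (hj : v j ≠ []) :
    WeightedRun (BlockStep w v) ([], j) (v j) 0 ([], j + 1) := by
  obtain ⟨t, x, hx⟩ := List.exists_cons_of_ne_nil hj
  have h1 := WeightedRun.cons (BlockStep.exit (w := w) t x j hx) (by
    simpa using blockRun_read (w := w) (v := v) x [] (j + 1))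
  rwa [← hx, add_zero] at h1

theorem exists_blockRun (n : ℕ → ℕ) (m j : ℕ) (hw : ∀ i, i < j + m → w i ≠ [])
    (hv : ∀ i, i < j + m → v i ≠ []) : ∃ c, (∀ i, j ≤ i → i < j + m → c i = n i) ∧
      WeightedRun (BlockStep w v) ([], j) (blockWord w v n m j) c ([], j + m) := by
  induction m generalizing j with
  | zero => exact ⟨0, by omega, .nil _⟩
  | succ m ih =>
    obtain ⟨c, hc, hrun⟩ := ih (j + 1) (fun i hi => hw i (by omega)) fun i hi => hv i (by omega)
    refine ⟨Pi.single j (n j) + 0 + c, fun i hi hi' => ?_, ?_⟩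
    · have h0 : c j = 0 := by
        by_contra h
        have := ((blockRun_mono hrun).2 j (Nat.pos_of_ne_zero h)).1
        simp at this
      rcases eq_or_ne i j with rfl | hij
      · simp [h0]
      · simp [hij, hc i (by omega) (by omega)]
    · rw [add_right_comm] at hrun
      exact ((blockRun_loop (hw j (by omega)) (n j)).append (blockRun_exit (hv j (by omega)))).append
        hrun

/-- The weights of a run determine its word, so no unique factorisation of words is needed. The
condition `w q.2 = []` excludes loops at the final index, which the block word would not record. -/
theorem eq_of_blockRun {p q : List T × ℕ} {x : List T} {c : ℕ → ℕ} {m : ℕ}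
    (h : WeightedRun (BlockStep w v) p x c q) (hw : w q.2 = []) (hq : q.1 = [])
    (hm : p.2 + m = q.2) : x = p.1 ++ blockWord w v c m p.2 := by
  induction h generalizing m with
  | nil p =>
    obtain rfl : m = 0 := by omega
    simp [hq, blockWord]
  | @cons p q r t x c d hs hrun ih =>
    cases hs with
    | read t y j => simp [ih hw hq hm]
    | loop t y j hj =>
      cases m with
      | zero =>
        simp only [add_zero] at hm
        rw [hm, hw] at hj
        cases hj
      | succ m =>
        have h1 : blockWord w v d m (j + 1) = blockWord w v (Pi.single j 1 + d) m (j + 1) :=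
          blockWord_congr w v _ _ fun i hi => by
            simp [show i ≠ j by omega]
        rw [ih hw hq hm, blockWord, blockWord, h1, Pi.add_apply, Pi.single_eq_same, add_comm 1,
          List.replicate_succ, List.flatten_cons, hj]
        simp
    | exit t y j hj =>
      have hmono := blockRun_mono hrun
      obtain _ | m := m
      · simp only [add_zero] at hm
        simp only at hmono
        omega
      · have h0 : d j = 0 := by
          by_contra h
          have := (hmono.2 j (Nat.pos_of_ne_zero h)).1
          simp at this
        rw [ih hw hq (m := m) (by simp only at hm ⊢; omega), blockWord, hj]
        simp [h0]

end BlockStep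

/-- `L` is not context-free if, for the words `P aᵏ Q bˡ R cᵐ U`, membership in `L` holds for
suitable `k < l < m`, but fails if `l` is much smaller than `k`, or `m` much smaller than `l`. -/
theorem Language.not_isContextFree_of_blocks {T : Type*} {L : Language T} {P a Q b R c U : List T}
    (ha : a ≠ []) (hQ : Q ≠ []) (hb : b ≠ []) (hR : R ≠ []) (hc : c ≠ []) (hU : U ≠ []) {C : ℕ}
    {W : ℕ → ℕ → ℕ → List T}
    (hW : ∀ k l m, W k l m = P ++ ((List.replicate k a).flatten ++ Q ++
      ((List.replicate l b).flatten ++ R ++ ((List.replicate m c).flatten ++ U))))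
    (hmem : ∀ N, C ≤ N → W N (N + C) (N + 2 * C) ∈ L)
    (hlk : ∀ k l m, C ≤ l → l + C ≤ k → W k l m ∉ L)
    (hml : ∀ k l m, C ≤ m → m + C ≤ l → W k l m ∉ L) : ¬ L.IsContextFree := by
  set w : ℕ → List T := fun i => if i = 0 then a else if i = 1 then b else if i = 2 then c else []
    with hwdef
  set v : ℕ → List T := fun i => if i = 0 then Q else if i = 1 then R else if i = 2 then U else []
    with hvdef
  have hword : ∀ n, P ++ blockWord w v n 3 0 = W (n 0) (n 1) (n 2) := fun n => by
    simp [blockWord, hW, hwdef, hvdef]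
  have hrun : ∀ {x n}, WeightedRun (BlockStep w v) (P, 0) x n ([], 3) →
      x = W (n 0) (n 1) (n 2) := fun {x n} h => by
    rw [← hword]
    exact eq_of_blockRun h (by simp [hwdef]) rfl rfl
  -- The part of a factor still to be read is a suffix of `P` or of one of the six blocks, so
  -- finitely many states suffice.
  let S : Set (List T) := {x | x <:+ P} ∪ ⋃ i ∈ Set.Iio 3, ({x | x <:+ w i} ∪ {x | x <:+ v i})
  have hsuf : ∀ y : List T, {x | x <:+ y}.Finite := fun y => by
    have := y.tails.finite_toSet
    simpa only [List.mem_tails] using this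
  have hS : S.Finite := (hsuf P).union
    ((Set.finite_Iio 3).biUnion fun i _ => (hsuf _).union (hsuf _))
  have hwv : ∀ i, 3 ≤ i → w i = [] ∧ v i = [] := fun i hi => by
    simp [hwdef, hvdef, show i ≠ 0 by omega, show i ≠ 1 by omega, show i ≠ 2 by omega]
  refine not_isContextFree_of_weightedRun (step := BlockStep w v) (F := S ×ˢ Set.Iic 3)
    (hS.prod (Set.finite_Iic 3)) ?_ (start := (P, 0)) (final := ([], 3))
    ⟨Or.inl (List.suffix_refl P), by simp⟩ (fun p t c q h => blockStep_weight_le h 1) ?_ ?_ C ?_ ?_ ?_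
  · rintro p t c q h ⟨hp, hp'⟩
    have hsub : ∀ i x, i < 3 → x <:+ w i ∨ x <:+ v i → x ∈ S := fun i x hi hx =>
      Or.inr (Set.mem_biUnion (Set.mem_Iio.2 hi) hx)
    cases h with
    | read t x j =>
      refine ⟨?_, hp'⟩
      rcases hp with hp | hp
      · exact Or.inl ((List.suffix_cons t x).trans hp)
      · obtain ⟨i, hi, hp⟩ := Set.mem_iUnion₂.1 hp
        exact hsub i x hi (hp.imp (List.suffix_cons t x).trans (List.suffix_cons t x).trans)
    | loop t x j hj =>
      have hj3 : j < 3 := by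
        by_contra h
        simp [(hwv j (by omega)).1] at hj
      exact ⟨hsub j x hj3 (Or.inl (hj ▸ List.suffix_cons t x)), hp'⟩
    | exit t x j hj =>
      have hj3 : j < 3 := by
        by_contra h
        simp [(hwv j (by omega)).2] at hj
      exact ⟨hsub j x hj3 (Or.inr (hj ▸ List.suffix_cons t x)), hj3⟩
  · intro p q r x y c d h1 h2 h
    have := ((blockRun_mono h1).2 1 h).2
    by_contra h0
    have := ((blockRun_mono h2).2 0 (Nat.pos_of_ne_zero h0)).1
    omega
  · intro p q r x y c d h1 h2 h
    have := ((blockRun_mono h2).2 1 h).1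
    by_contra h0
    have := ((blockRun_mono h1).2 2 (Nat.pos_of_ne_zero h0)).2
    omega
  · intro N hN
    have h3 : ∀ i, i < 0 + 3 → w i ≠ [] ∧ v i ≠ [] := by
      intro i hi
      obtain rfl | rfl | rfl : i = 0 ∨ i = 1 ∨ i = 2 := by omega
      all_goals simp [hwdef, hvdef, *]
    obtain ⟨n, hn, h⟩ := exists_blockRun (w := w) (v := v) (fun i => N + i * C) 3 0
      (fun i hi => (h3 i hi).1) fun i hi => (h3 i hi).2
    have h' := (blockRun_read (w := w) (v := v) P [] 0)
    rw [List.append_nil] at h'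
    have h'' := h'.append h
    rw [zero_add] at h''
    have e0 := hn 0 le_rfl (by omega)
    have e1 := hn 1 (by omega) (by omega)
    have e2 := hn 2 (by omega) (by omega)
    simp only [zero_mul, one_mul, add_zero] at e0 e1 e2
    refine ⟨_, ?_, n, h'', e0, e1, e2⟩
    rw [hrun h'', e0, e1, e2]
    exact hmem N hN
  · intro x n h h1 h2
    rw [hrun h]
    exact hlk _ _ _ h1 h2
  · intro x n h h1 h2
    rw [hrun h]
    exact hml _ _ _ h1 h2

namespace SAWLang

/-! ### Labels and vertex sets of walks -/

section Spelling

variable {V A : Type*} {X : SimpleGraph V} {ℓ : X.Dart → A}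

/-- Some walk from `u` to `v` with vertex set `S` has label `w`. -/
def Spells (ℓ : X.Dart → A) (u : V) (w : List A) (v : V) (S : Set V) : Prop :=
  ∃ p : X.Walk u v, p.darts.map ℓ = w ∧ {z | z ∈ p.support} = S

/-- Some self-avoiding walk from `u` to `v` with vertex set `S` has label `w`. -/
def SpellsPath (ℓ : X.Dart → A) (u : V) (w : List A) (v : V) (S : Set V) : Prop :=
  ∃ p : X.Walk u v, p.IsPath ∧ p.darts.map ℓ = w ∧ {z | z ∈ p.support} = S

theorem SpellsPath.spells {u v : V} {w : List A} {S : Set V} (h : SpellsPath ℓ u w v S) :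
    Spells ℓ u w v S := by
  obtain ⟨p, -, h1, h2⟩ := h
  exact ⟨p, h1, h2⟩

theorem Spells.append {u v x : V} {w w' : List A} {S S' : Set V} (h : Spells ℓ u w v S)
    (h' : Spells ℓ v w' x S') : Spells ℓ u (w ++ w') x (S ∪ S') := by
  obtain ⟨p, rfl, rfl⟩ := h
  obtain ⟨q, rfl, rfl⟩ := h'
  exact ⟨p.append q, by simp, by ext; simp [SimpleGraph.Walk.mem_support_append_iff]⟩

theorem SpellsPath.append {u v x : V} {w w' : List A} {S S' : Set V} (h : SpellsPath ℓ u w v S)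
    (h' : SpellsPath ℓ v w' x S') (hS : ∀ z ∈ S, z ∈ S' → z = v) :
    SpellsPath ℓ u (w ++ w') x (S ∪ S') := by
  obtain ⟨p, hp, rfl, rfl⟩ := h
  obtain ⟨q, hq, rfl, rfl⟩ := h'
  refine ⟨p.append q, ?_, by simp, by ext; simp [SimpleGraph.Walk.mem_support_append_iff]⟩
  rw [SimpleGraph.Walk.isPath_def] at hp hq ⊢
  rw [SimpleGraph.Walk.support_append, List.nodup_append']
  rw [← SimpleGraph.Walk.cons_tail_support, List.nodup_cons] at hq
  refine ⟨hp, hq.2, fun z hz hz' => ?_⟩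
  obtain rfl := hS z hz (List.mem_of_mem_tail hz')
  exact hq.1 hz'

theorem SpellsPath.map {γ : X ≃g X} (hγ : γ ∈ labelAut X ℓ) {u v : V} {w : List A} {S : Set V}
    (h : SpellsPath ℓ u w v S) : SpellsPath ℓ (γ u) w (γ v) (γ '' S) := by
  obtain ⟨p, hp, rfl, rfl⟩ := h
  refine ⟨p.map γ.toHom, hp.map γ.injective, ?_, ?_⟩
  · rw [SimpleGraph.Walk.darts_map, List.map_map]
    exact List.map_congr_left fun d _ => hγ d
  · ext z
    simp

theorem SpellsPath.exists_reverse {u v : V} {w : List A} {S : Set V} (h : SpellsPath ℓ u w v S) :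
    ∃ w', SpellsPath ℓ v w' u S := by
  obtain ⟨p, hp, -, rfl⟩ := h
  exact ⟨_, p.reverse, hp.reverse, rfl, by simp⟩

theorem Spells.right_mem {u v : V} {w : List A} {S : Set V} (h : Spells ℓ u w v S) : v ∈ S := by
  obtain ⟨p, -, rfl⟩ := h
  exact p.end_mem_support

theorem Spells.finite {u v : V} {w : List A} {S : Set V} (h : Spells ℓ u w v S) : S.Finite := by
  obtain ⟨p, -, rfl⟩ := h
  exact p.support.finite_toSet

theorem Spells.ne_nil {u v : V} {w : List A} {S : Set V} (h : Spells ℓ u w v S) (huv : u ≠ v) :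
    w ≠ [] := by
  obtain ⟨p, rfl, -⟩ := h
  cases p with
  | nil => exact absurd rfl huv
  | cons => simp

theorem SpellsPath.mem_sawLanguage {o v : V} {w : List A} {S : Set V}
    (h : SpellsPath ℓ o w v S) : w ∈ sawLanguage X ℓ o := by
  obtain ⟨p, hp, rfl, -⟩ := h
  exact ⟨v, p, hp, rfl⟩

theorem support_eq_of_label_eq (hdet : IsDeterministic X ℓ) {u v v' : V} (p : X.Walk u v)
    (q : X.Walk u v') (h : p.darts.map ℓ = q.darts.map ℓ) : p.support = q.support := by
  induction p generalizing v' with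
  | nil => cases q with
    | nil => rfl
    | cons => simp at h
  | @cons a b c hab p ih =>
    cases q with
    | nil => simp at h
    | @cons _ d _ had q =>
      simp only [SimpleGraph.Walk.darts_cons, List.map_cons, List.cons.injEq] at h
      have hd : (⟨(a, b), hab⟩ : X.Dart) = ⟨(a, d), had⟩ := by
        by_contra hne
        exact hdet _ _ hne (Or.inl rfl) h.1
      obtain rfl : b = d := congrArg (fun d : X.Dart => d.snd) hd
      rw [SimpleGraph.Walk.support_cons, SimpleGraph.Walk.support_cons, ih q h.2]

/-- By determinism the concatenated walk is the only one from `o` with this label, and it visits `z`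
both before and after the junction `v`. -/
theorem not_mem_sawLanguage (hdet : IsDeterministic X ℓ) {o v x z : V} {w w' : List A}
    {S S' : Set V} (h : Spells ℓ o w v S) (h' : Spells ℓ v w' x S') (hz : z ∈ S) (hz' : z ∈ S')
    (hne : z ≠ v) : w ++ w' ∉ sawLanguage X ℓ o := by
  obtain ⟨p, rfl, rfl⟩ := h
  obtain ⟨q, rfl, rfl⟩ := h'
  rintro ⟨y, r, hr, h⟩
  have hpq : (p.append q).IsPath := by
    rw [SimpleGraph.Walk.isPath_def] at hr ⊢
    rwa [support_eq_of_label_eq hdet (p.append q) r (by simpa using h)]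
  exact hpq.ne_of_mem_support_of_append hne hz hz' rfl

/-- Fixing a vertex forces fixing its neighbours, since the edges at it have distinct labels; this
spreads by connectedness. -/
theorem eq_one_of_apply_eq (hconn : X.Connected) (hdet : IsDeterministic X ℓ) {γ : X ≃g X}
    (hγ : γ ∈ labelAut X ℓ) {u : V} (hu : γ u = u) : γ = 1 := by
  ext v
  obtain ⟨p⟩ := hconn.preconnected u v
  induction p with
  | nil => exact hu
  | @cons a b c hab p ih =>
    refine ih ?_
    have h := hγ ⟨(a, b), hab⟩
    by_contra hne
    refine hdet _ _ (fun hd => hne ?_) (Or.inl ?_) h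
    · exact congrArg (fun d : X.Dart => d.snd) hd
    · exact hu

variable (ℓ)

theorem exists_spellsPath_subset {u v : V} (p : X.Walk u v) {x y : V} (hx : x ∈ p.support)
    (hy : y ∈ p.support) : ∃ w S, SpellsPath ℓ x w y S ∧ S ⊆ {z | z ∈ p.support} := by
  classical
  let q := ((p.takeUntil x hx).reverse.append (p.takeUntil y hy)).bypass
  refine ⟨_, _, ⟨q, SimpleGraph.Walk.bypass_isPath _, rfl, rfl⟩, fun z hz => ?_⟩
  have := SimpleGraph.Walk.support_bypass_subset_support _ hz
  rw [SimpleGraph.Walk.mem_support_append_iff, SimpleGraph.Walk.support_reverse,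
    List.mem_reverse] at this
  exact this.elim (fun h => p.support_takeUntil_subset_support hx h)
    fun h => p.support_takeUntil_subset_support hy h

/-- A shortest path between two sets of vertices meets them only in its end vertices. -/
theorem exists_spellsPath_direct (hconn : X.Connected) {P Q : Set V} (hP : P.Nonempty)
    (hQ : Q.Nonempty) : ∃ u ∈ P, ∃ v ∈ Q, ∃ w S, SpellsPath ℓ u w v S ∧
      ∀ z ∈ S, (z ∈ P → z = u) ∧ (z ∈ Q → z = v) := by
  classical
  have hne : ∃ n, ∃ u ∈ P, ∃ v ∈ Q, ∃ p : X.Walk u v, p.length = n := by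
    obtain ⟨u, hu⟩ := hP
    obtain ⟨v, hv⟩ := hQ
    obtain ⟨p⟩ := hconn.preconnected u v
    exact ⟨_, u, hu, v, hv, p, rfl⟩
  obtain ⟨u, hu, v, hv, p, hp⟩ := Nat.find_spec hne
  have hmin : ∀ u ∈ P, ∀ v ∈ Q, ∀ q : X.Walk u v, p.length ≤ q.length := fun u hu v hv q => by
    rw [hp]
    exact Nat.find_min' hne ⟨u, hu, v, hv, q, rfl⟩
  have key : ∀ z ∈ p.support, (z ∈ P → z = u) ∧ (z ∈ Q → z = v) := fun z hz => by
    have hlen : (p.takeUntil z hz).length + (p.dropUntil z hz).length = p.length := by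
      rw [← SimpleGraph.Walk.length_append, SimpleGraph.Walk.take_spec]
    constructor
    · intro h
      have := hmin z h v hv (p.dropUntil z hz)
      exact (SimpleGraph.Walk.eq_of_length_eq_zero (p := p.takeUntil z hz) (by omega)).symm
    · intro h
      have := hmin u hu z h (p.takeUntil z hz)
      exact SimpleGraph.Walk.eq_of_length_eq_zero (p := p.dropUntil z hz) (by omega)
  exact ⟨u, hu, v, hv, _, _, ⟨p.bypass, p.bypass_isPath, rfl, rfl⟩,
    fun z hz => key z (p.support_bypass_subset_support hz)⟩

theorem exists_max_index {ρ : ℤ → V} (hρ : Function.Injective ρ) {F : Set V} (hF : F.Finite)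
    {t₀ : ℤ} (h₀ : ρ t₀ ∈ F) : ∃ s, ρ s ∈ F ∧ ∀ t, ρ t ∈ F → t ≤ s := by
  have hfin : (ρ ⁻¹' F).Finite := hF.preimage hρ.injOn
  obtain ⟨s, hs, hmax⟩ := Set.exists_max_image _ id hfin ⟨t₀, h₀⟩
  exact ⟨s, hs, hmax⟩

/-- Two sequences of vertices are connected by a path whose ends have the largest index in either
sequence. -/
theorem exists_spellsPath_max (hconn : X.Connected) {ρ σ : ℤ → V} (hρ : Function.Injective ρ)
    (hσ : Function.Injective σ) : ∃ s t w S, SpellsPath ℓ (ρ s) w (σ t) S ∧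
      (∀ i, ρ i ∈ S → i ≤ s) ∧ ∀ i, σ i ∈ S → i ≤ t := by
  -- Any walk will do: its support is finite, and the vertices of largest index on it are joined by
  -- a path inside that support.
  obtain ⟨p⟩ := hconn.preconnected (ρ 0) (σ 0)
  obtain ⟨s, hs, hs'⟩ := exists_max_index hρ p.support.finite_toSet p.start_mem_support
  obtain ⟨t, ht, ht'⟩ := exists_max_index hσ p.support.finite_toSet p.end_mem_support
  obtain ⟨w, S, h, hS⟩ := exists_spellsPath_subset ℓ p hs ht
  exact ⟨s, t, w, S, h, fun i hi => hs' i (hS hi), fun i hi => ht' i (hS hi)⟩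

theorem exists_spellsPath_of_adj {ρ : ℤ → V} (hρ : Function.Injective ρ)
    (hadj : ∀ t, X.Adj (ρ t) (ρ (t + 1))) {s t : ℤ} (hst : s ≤ t) :
    ∃ w, SpellsPath ℓ (ρ s) w (ρ t) (ρ '' Set.Icc s t) := by
  induction t, hst using Int.leInduction with
  | base => exact ⟨_, .nil, by simp, rfl, by simp⟩
  | succ t hst ih =>
    obtain ⟨w, h⟩ := ih
    have h1 : SpellsPath ℓ (ρ t) [ℓ ⟨(ρ t, ρ (t + 1)), hadj t⟩] (ρ (t + 1))
        {ρ t, ρ (t + 1)} := by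
      refine ⟨(hadj t).toWalk, by simp [(hadj t).ne], by simp, by ext; simp⟩
    have hset : ρ '' Set.Icc s t ∪ {ρ t, ρ (t + 1)} = ρ '' Set.Icc s (t + 1) := by
      ext z
      constructor
      · rintro (⟨i, ⟨hi, hi'⟩, rfl⟩ | rfl | rfl)
        · exact ⟨i, ⟨hi, by omega⟩, rfl⟩
        · exact ⟨t, ⟨hst, by omega⟩, rfl⟩
        · exact ⟨t + 1, ⟨by omega, le_rfl⟩, rfl⟩
      · rintro ⟨i, ⟨hi, hi'⟩, rfl⟩
        rcases hi'.lt_or_eq with h | rfl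
        · exact Or.inl ⟨i, ⟨hi, by omega⟩, rfl⟩
        · exact Or.inr (Or.inr rfl)
    have h2 := h.append h1 (by
      rintro z ⟨i, ⟨hi, hi'⟩, rfl⟩ (h | h)
      · exact h
      · have := hρ h
        omega)
    rw [hset] at h2
    exact ⟨_, h2⟩

end Spelling

/-! ### Lanes and translates -/

section Lane

variable {V A : Type*}

/-- A double ray on which the automorphism `τ` acts as a translation in the positive direction. -/
structure Lane (X : SimpleGraph V) (τ : X ≃g X) where
  vert : ℤ → V
  inj : Function.Injective vert
  adj : ∀ t, X.Adj (vert t) (vert (t + 1))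
  shift : ℤ
  shift_pos : 0 < shift
  map_vert : ∀ t, τ (vert t) = vert (t + shift)

namespace Lane

variable {X : SimpleGraph V} {τ : X ≃g X} {ℓ : X.Dart → A}

theorem zpow_apply (R : Lane X τ) (n t : ℤ) : (τ ^ n) (R.vert t) = R.vert (t + n * R.shift) := by
  induction n with
  | zero => simp
  | succ n ih =>
    rw [add_comm, zpow_one_add, RelIso.mul_apply, ih, R.map_vert]
    congr 1
    ring
  | pred n ih =>
    rw [sub_eq_neg_add, zpow_add, zpow_neg_one, RelIso.mul_apply, ih, ← τ.injective.eq_iff,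
      RelIso.apply_inv_self, R.map_vert]
    congr 1
    ring

/-- The same double ray, in the opposite direction. -/
def reverse (R : Lane X τ) : Lane X τ⁻¹ where
  vert t := R.vert (-t)
  inj := R.inj.comp neg_injective
  adj t := by
    have := (R.adj (-(t + 1))).symm
    rwa [show -(t + 1) + 1 = -t by ring] at this
  shift := R.shift
  shift_pos := R.shift_pos
  map_vert t := by
    rw [← τ.injective.eq_iff, RelIso.apply_inv_self, R.map_vert]
    congr 1
    ring

theorem spellsPath_period (R : Lane X τ) (hτ : τ ∈ labelAut X ℓ) {s : ℤ} {a : List A}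
    (h : SpellsPath ℓ (R.vert s) a (R.vert (s + R.shift))
      (R.vert '' Set.Icc s (s + R.shift))) (k : ℕ) :
    SpellsPath ℓ (R.vert s) (List.replicate k a).flatten (R.vert (s + k * R.shift))
      (R.vert '' Set.Icc s (s + k * R.shift)) := by
  have hd := R.shift_pos
  induction k with
  | zero => exact ⟨.copy .nil rfl (by simp), by simp, by simp, by simp⟩
  | succ k ih =>
    have h1 := h.map ((labelAut X ℓ).zpow_mem hτ k)
    rw [R.zpow_apply, R.zpow_apply] at h1
    have hk : 0 ≤ k * R.shift := by positivity
    have e : s + R.shift + k * R.shift = s + ((k + 1 : ℕ) : ℤ) * R.shift := by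
      push_cast
      ring
    have himg : (τ ^ (k : ℤ)) '' (R.vert '' Set.Icc s (s + R.shift)) =
        R.vert '' Set.Icc (s + k * R.shift) (s + ((k + 1 : ℕ) : ℤ) * R.shift) := by
      rw [← e, ← Set.image_add_const_Icc, Set.image_image, Set.image_image]
      exact Set.image_congr fun t _ => R.zpow_apply _ _
    rw [himg, e] at h1
    have h2 := ih.append h1 (by
      rintro z ⟨i, hi, rfl⟩ ⟨j, hj, hij⟩
      obtain rfl := R.inj hij
      rw [le_antisymm hi.2 hj.1])
    rw [← Set.image_union, Set.Icc_union_Icc_eq_Icc (by omega) (by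
      rw [← e]; omega)] at h2
    rwa [List.replicate_succ', List.flatten_append, List.flatten_singleton]

theorem image_reverse_Icc (R : Lane X τ) (s t : ℤ) :
    R.reverse.vert '' Set.Icc s t = R.vert '' Set.Icc (-t) (-s) := by
  rw [← Set.image_neg_Icc, Set.image_image]
  rfl

theorem spellsPath_reverse_period (R : Lane X τ) (hτ : τ ∈ labelAut X ℓ) {s : ℤ} {a : List A}
    (h : SpellsPath ℓ (R.vert s) a (R.vert (s - R.shift))
      (R.vert '' Set.Icc (s - R.shift) s)) (k : ℕ) :
    SpellsPath ℓ (R.vert s) (List.replicate k a).flatten (R.vert (s - k * R.shift))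
      (R.vert '' Set.Icc (s - k * R.shift) s) := by
  have e : ∀ t, R.reverse.vert t = R.vert (-t) := fun _ => rfl
  have e' : R.reverse.shift = R.shift := rfl
  have h1 := R.reverse.spellsPath_period ((labelAut X ℓ).inv_mem hτ) (s := -s) (a := a) (by
    rw [image_reverse_Icc, e, e, e']
    convert h using 3 <;> ring_nf) k
  rw [image_reverse_Icc, e, e, e'] at h1
  convert h1 using 3 <;> ring_nf

/-- A repetition would make a nonzero power of `τ` fix a vertex, hence be the identity, although it
shifts the lane. -/
theorem zpow_apply_injective (R : Lane X τ) (hconn : X.Connected) (hdet : IsDeterministic X ℓ)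
    (hτ : τ ∈ labelAut X ℓ) (x : V) : Function.Injective fun n : ℤ => (τ ^ n) x := by
  intro m n hmn
  have h1 : (τ ^ (-n + m)) x = x := by
    simp only at hmn
    rw [zpow_add, RelIso.mul_apply, hmn, ← RelIso.mul_apply, ← zpow_add]
    simp
  have h2 := eq_one_of_apply_eq hconn hdet ((labelAut X ℓ).zpow_mem hτ _) h1
  have h3 := R.zpow_apply (-n + m) 0
  rw [h2] at h3
  have h4 := R.inj h3
  rw [zero_add, eq_comm, mul_eq_zero] at h4
  have := R.shift_pos
  omega

/-- High translates of a finite set of vertices are disjoint from it. -/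
theorem exists_disjoint_translates (R : Lane X τ) (hconn : X.Connected)
    (hdet : IsDeterministic X ℓ) (hτ : τ ∈ labelAut X ℓ) {F : Set V} (hF : F.Finite) :
    ∃ C : ℕ, ∀ m n : ℤ, m + C ≤ n → ∀ x ∈ F, ∀ y ∈ F, (τ ^ m) x ≠ (τ ^ n) y := by
  -- Only finitely many powers of `τ` bring a vertex of `F` back to `F`.
  have hfin : (⋃ x ∈ F, (fun n : ℤ => (τ ^ n) x) ⁻¹' F).Finite :=
    hF.biUnion fun x _ => hF.preimage (R.zpow_apply_injective hconn hdet hτ x).injOn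
  obtain ⟨B, hB⟩ := hfin.bddAbove
  refine ⟨(B + 1).toNat, fun m n hmn x hx y hy h => ?_⟩
  have h1 : (τ ^ (n - m)) y = x := by
    rw [sub_eq_neg_add, zpow_add, RelIso.mul_apply, ← h, ← RelIso.mul_apply, ← zpow_add]
    simp
  have : n - m ≤ B := hB (Set.mem_biUnion hy (by
    change (τ ^ (n - m)) y ∈ F
    rwa [h1]))
  omega

end Lane

end Lane

/-! ### The walk along three linked lanes -/

section Lane

variable {V A : Type*} {X : SimpleGraph V} {τ : X ≃g X} {ℓ : X.Dart → A}

theorem Lane.vert_mem_zpow_image (R : Lane X τ) {n t : ℤ} {S : Set V} :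
    R.vert t ∈ (τ ^ n) '' S ↔ R.vert (t - n * R.shift) ∈ S := by
  have h : (τ ^ n) (R.vert (t - n * R.shift)) = R.vert t := by
    rw [R.zpow_apply]
    congr 1
    ring
  rw [← h, (τ ^ n).injective.mem_set_image]

theorem Lane.zpow_image_Icc (R : Lane X τ) (n s t : ℤ) :
    (τ ^ n) '' (R.vert '' Set.Icc s t) =
      R.vert '' Set.Icc (s + n * R.shift) (t + n * R.shift) := by
  rw [← Set.image_add_const_Icc, Set.image_image, Set.image_image]
  exact Set.image_congr fun t _ => R.zpow_apply _ _

theorem Lane.le_mul_shift (R : Lane X τ) (n : ℕ) : (n : ℤ) ≤ n * R.shift :=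
  le_mul_of_one_le_right (by positivity) R.shift_pos

theorem Lane.exists_index_bound (R : Lane X τ) {S : Set V} (hS : S.Finite) :
    ∃ B : ℕ, ∀ t, R.vert t ∈ S → -B ≤ t ∧ t ≤ B := by
  have hfin : (R.vert ⁻¹' S).Finite := hS.preimage R.inj.injOn
  obtain ⟨B, hB⟩ := hfin.bddAbove
  obtain ⟨B', hB'⟩ := hfin.bddBelow
  refine ⟨B.toNat + (-B').toNat, fun t ht => ?_⟩
  have h1 : t ≤ B := hB ht
  have h2 : B' ≤ t := hB' ht
  omega

/-- Three lanes `I`, `J`, `H` joined by suitable paths admit self-avoiding walks running along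
`I`, back along `J`, and then along `H`, where the lengths of these parts have to increase. -/
theorem not_isContextFree_of_linked_lanes (hconn : X.Connected) (hdet : IsDeterministic X ℓ)
    (hτ : τ ∈ labelAut X ℓ) (I J H : Lane X τ)
    (hIJ : ∀ s t, I.vert s ≠ J.vert t) (hIH : ∀ s t, I.vert s ≠ H.vert t)
    (hJH : ∀ s t, J.vert s ≠ H.vert t) {o : V} {s p q y y' z z' : ℤ} {wP wE wY wZ : List A}
    {P E Y Z : Set V}
    (hP : SpellsPath ℓ o wP (I.vert s) P) (hPI : ∀ t, I.vert t ∈ P → t = s)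
    (hPJ : ∀ t, J.vert t ∉ P) (hPH : ∀ t, H.vert t ∉ P) (hsp : s ≤ p)
    (hE : SpellsPath ℓ (I.vert p) wE (J.vert q) E) (hEI : ∀ t, I.vert t ∈ E → t = p)
    (hEJ : ∀ t, J.vert t ∈ E → t = q) (hEH : ∀ t, H.vert t ∉ E)
    (hY : SpellsPath ℓ (I.vert y) wY (H.vert y') Y) (hYI : ∀ t, I.vert t ∈ Y → t ≤ y)
    (hYJ : ∀ t, J.vert t ∈ Y → t < q) (hYH : ∀ t, H.vert t ∈ Y → t ≤ y') (hyp : y ≤ p)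
    (hYE : ∀ x ∈ E, x ∉ Y)
    (hZ : SpellsPath ℓ (H.vert z) wZ (J.vert z') Z) (hZH : ∀ t, H.vert t ∈ Z → z ≤ t)
    (hyz : y' ≤ z) : ¬ (sawLanguage X ℓ o).IsContextFree := by
  have hI := I.shift_pos
  have hJ := J.shift_pos
  have hH := H.shift_pos
  have hz : ∀ n : ℤ, τ ^ n ∈ labelAut X ℓ := fun n => (labelAut X ℓ).zpow_mem hτ n
  obtain ⟨w₁, hw₁⟩ := exists_spellsPath_of_adj ℓ I.inj I.adj hsp
  obtain ⟨a, ha⟩ := exists_spellsPath_of_adj ℓ I.inj I.adj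
    (show p ≤ p + I.shift by omega)
  obtain ⟨b', hb'⟩ := exists_spellsPath_of_adj ℓ J.inj J.adj
    (show q - J.shift ≤ q by omega)
  obtain ⟨b, hb⟩ := hb'.exists_reverse
  obtain ⟨wE', hE'⟩ := hE.exists_reverse
  obtain ⟨w₅', hw₅'⟩ := exists_spellsPath_of_adj ℓ I.inj I.adj hyp
  obtain ⟨w₅, hw₅⟩ := hw₅'.exists_reverse
  obtain ⟨w₇, hw₇⟩ := exists_spellsPath_of_adj ℓ H.inj H.adj hyz
  obtain ⟨c, hc⟩ := exists_spellsPath_of_adj ℓ H.inj H.adj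
    (show z ≤ z + H.shift by omega)
  -- The five stretches of the walk: out along `I`; across to `J` (`h2`); back along `J` (`h3`);
  -- across to `I`, down to `Y`, over to `H` and forward (`h4`); back to `J` (`h5`).
  have h1 : ∀ k : ℕ, SpellsPath ℓ o (wP ++ (w₁ ++ (List.replicate k a).flatten))
      (I.vert (p + k * I.shift)) (P ∪ I.vert '' Set.Icc s (p + k * I.shift)) := by
    intro k
    have hk := I.le_mul_shift k
    have h := hw₁.append (I.spellsPath_period hτ ha k) (by
      rintro _ ⟨i, hi, rfl⟩ ⟨j, hj, hij⟩
      obtain rfl := I.inj hij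
      rw [le_antisymm hi.2 hj.1])
    rw [← Set.image_union, Set.Icc_union_Icc_eq_Icc hsp (by omega)] at h
    refine hP.append h ?_
    rintro _ hx ⟨i, hi, rfl⟩
    rw [hPI i hx]
  have h2 : ∀ k : ℕ, SpellsPath ℓ (I.vert (p + k * I.shift)) wE (J.vert (q + k * J.shift))
      ((τ ^ (k : ℤ)) '' E) := by
    intro k
    have h := hE.map (hz k)
    rwa [I.zpow_apply, J.zpow_apply] at h
  have h3 : ∀ k l : ℕ, SpellsPath ℓ (J.vert (q + k * J.shift)) (List.replicate l b).flatten
      (J.vert (q + (k - l : ℤ) * J.shift))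
      (J.vert '' Set.Icc (q + (k - l : ℤ) * J.shift) (q + k * J.shift)) := by
    intro k l
    have h := (J.spellsPath_reverse_period hτ hb l).map (hz k)
    rw [J.zpow_apply, J.zpow_apply, J.zpow_image_Icc] at h
    rwa [show q + (k - l : ℤ) * J.shift = q - l * J.shift + k * J.shift by ring]
  have h4 : ∀ k l m : ℕ, SpellsPath ℓ (J.vert (q + (k - l : ℤ) * J.shift))
      (wE' ++ w₅ ++ wY ++ (w₇ ++ (List.replicate m c).flatten))
      (H.vert (z + (k - l + m : ℤ) * H.shift))
      ((τ ^ (k - l : ℤ)) '' (E ∪ I.vert '' Set.Icc y p ∪ Y ∪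
        H.vert '' Set.Icc y' (z + m * H.shift))) := by
    intro k l m
    have hm := H.le_mul_shift m
    have h := hw₇.append (H.spellsPath_period hτ hc m) (by
      rintro _ ⟨i, hi, rfl⟩ ⟨j, hj, hij⟩
      obtain rfl := H.inj hij
      rw [le_antisymm hi.2 hj.1])
    rw [← Set.image_union, Set.Icc_union_Icc_eq_Icc hyz (by omega)] at h
    have h' := ((hE'.append hw₅ (by
      rintro _ hx ⟨i, hi, rfl⟩
      rw [hEI i hx])).append hY (by
      rintro _ (hx | ⟨i, hi, rfl⟩) hx'
      · exact absurd hx' (hYE _ hx)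
      · rw [le_antisymm (hYI i hx') hi.1])).append h (by
      rintro _ ((hx | ⟨i, hi, rfl⟩) | hx) ⟨j, hj, hij⟩
      · exact absurd (hij ▸ hx) (hEH j)
      · exact absurd hij.symm (hIH i j)
      · rw [← hij] at hx ⊢
        rw [le_antisymm (hYH j hx) hj.1])
    have h'' := h'.map (hz (k - l))
    rw [J.zpow_apply, H.zpow_apply] at h''
    rwa [show z + (k - l + m : ℤ) * H.shift = z + m * H.shift + (k - l : ℤ) * H.shift by ring]
  have h5 : ∀ k l m : ℕ, SpellsPath ℓ (H.vert (z + (k - l + m : ℤ) * H.shift)) wZ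
      (J.vert (z' + (k - l + m : ℤ) * J.shift)) ((τ ^ (k - l + m : ℤ)) '' Z) := by
    intro k l m
    have h := hZ.map (hz (k - l + m))
    rwa [H.zpow_apply, J.zpow_apply] at h
  obtain ⟨D, hD⟩ := I.exists_disjoint_translates hconn hdet hτ
    (((hP.spells.finite.union hE.spells.finite).union hY.spells.finite).union hZ.spells.finite)
  obtain ⟨B, hB⟩ := I.exists_index_bound hZ.spells.finite
  obtain ⟨B', hB'⟩ := J.exists_index_bound hZ.spells.finite
  -- Large enough to separate translates of the links, to push `Z` past the runs on `I` and `J`, and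
  -- to absorb all offsets.
  set C : ℕ := D + B + B' + p.natAbs + q.natAbs + s.natAbs + z'.natAbs + 1 with hC
  refine Language.not_isContextFree_of_blocks (P := wP ++ w₁) (a := a) (Q := wE) (b := b)
    (R := wE' ++ w₅ ++ wY ++ w₇) (c := c) (U := wZ)
    (ha.spells.ne_nil fun h => by have := I.inj h; omega)
    (hE.spells.ne_nil (hIJ _ _)) (hb.spells.ne_nil fun h => by have := J.inj h; omega)
    ?_ (hc.spells.ne_nil fun h => by have := H.inj h; omega)
    (hZ.spells.ne_nil fun h => hJH _ _ h.symm) (C := C)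
    (W := fun k l m => (((wP ++ (w₁ ++ (List.replicate k a).flatten)) ++ wE) ++
      (List.replicate l b).flatten ++ (wE' ++ w₅ ++ wY ++ (w₇ ++ (List.replicate m c).flatten))) ++
        wZ) (fun k l m => by simp only [List.append_assoc]) ?_ ?_ ?_
  · have := hE'.spells.ne_nil (hIJ _ _).symm
    simp [this]
  · intro N hN
    have hCI := I.le_mul_shift C
    have hCJ := J.le_mul_shift C
    have hNI := I.le_mul_shift N
    have hNJ := J.le_mul_shift N
    have e : ((N : ℤ) - (N + C : ℕ)) = -C := by push_cast; ring
    have e' : (-(C : ℤ) + (N + 2 * C : ℕ)) = N + C := by push_cast; ring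
    have g1 := h1 N
    have g2 := h2 N
    have g3 := h3 N (N + C)
    have g4 := h4 N (N + C) (N + 2 * C)
    have g5 := h5 N (N + C) (N + 2 * C)
    rw [e] at g3 g4 g5
    rw [e'] at g4 g5
    -- The links occur translated by `-C`, `0`, `N` and `N + C`, exponents at least `C` apart, so
    -- links with different exponents are disjoint.
    have hD' : ∀ m n : ℤ, m + C ≤ n → ∀ x ∈ P ∪ E ∪ Y ∪ Z, ∀ y ∈ P ∪ E ∪ Y ∪ Z,
        (τ ^ m) x ≠ (τ ^ n) y := fun m n hmn => hD m n (by omega)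
    have hD₀ : ∀ n : ℤ, n ≤ -C ∨ C ≤ n → ∀ x ∈ P ∪ E ∪ Y ∪ Z, ∀ y ∈ P ∪ E ∪ Y ∪ Z,
        (τ ^ n) x ≠ y := by
      rintro n (hn | hn) x hx y hy h
      · exact hD' n 0 (by omega) x hx y hy h
      · exact hD' 0 n (by omega) y hy x hx h.symm
    have g12 := g1.append g2 (by
      rintro _ (hx | ⟨i, hi, rfl⟩) hx'
      · obtain ⟨x, hx', rfl⟩ := hx'
        exact absurd rfl (hD₀ N (by omega) x (by simp [hx']) _ (Or.inl (Or.inl (Or.inl hx))))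
      · have := hEI _ (I.vert_mem_zpow_image.1 hx')
        rw [show i = p + N * I.shift by omega])
    have g123 := g12.append g3 (by
      rintro _ ((hx | ⟨i, hi, rfl⟩) | hx) ⟨j, hj, hij⟩
      · exact absurd (hij ▸ hx) (hPJ j)
      · exact absurd hij.symm (hIJ i j)
      · rw [← hij] at hx ⊢
        have := hEJ _ (J.vert_mem_zpow_image.1 hx)
        rw [show j = q + N * J.shift by omega])
    -- The second visit to `I` stays below `p - C * I.shift`, hence behind `s`. Of the links
    -- translated by `-C`, `E` meets `J` only at the junction and `Y` only strictly behind it.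
    have g1234 := g123.append g4 (by
      simp only [Set.image_union, I.zpow_image_Icc, H.zpow_image_Icc, neg_mul]
      rintro _ (((hx | ⟨i, hi, rfl⟩) | hx) | ⟨i, hi, rfl⟩)
        (((hx' | ⟨j, hj, hij⟩) | hx') | ⟨j, hj, hij⟩)
      · obtain ⟨x, hx', rfl⟩ := hx'
        exact absurd rfl (hD₀ (-C) (by omega) x (by simp [hx']) _ (Or.inl (Or.inl (Or.inl hx))))
      · have := hPI j (hij ▸ hx)
        have := hj.2
        omega
      · obtain ⟨x, hx', rfl⟩ := hx'
        exact absurd rfl (hD₀ (-C) (by omega) x (by simp [hx']) _ (Or.inl (Or.inl (Or.inl hx))))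
      · exact absurd (hij ▸ hx) (hPH j)
      · have h := hEI _ (I.vert_mem_zpow_image.1 hx')
        have := hi.1
        rw [neg_mul] at h
        omega
      · have := I.inj hij
        have := hi.1
        have := hj.2
        omega
      · have h := hYI _ (I.vert_mem_zpow_image.1 hx')
        have := hi.1
        rw [neg_mul] at h
        omega
      · exact absurd hij.symm (hIH i j)
      · obtain ⟨x, hx, rfl⟩ := hx
        obtain ⟨x', hx', h⟩ := hx'
        exact absurd h (hD' (-C) N (by omega) x' (by simp [hx']) x (by simp [hx]))
      · have h := hEI _ (I.vert_mem_zpow_image.1 (hij ▸ hx))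
        have := hj.2
        omega
      · obtain ⟨x, hx, rfl⟩ := hx
        obtain ⟨x', hx', h⟩ := hx'
        exact absurd h (hD' (-C) N (by omega) x' (by simp [hx']) x (by simp [hx]))
      · exact absurd (H.vert_mem_zpow_image.1 (hij ▸ hx)) (hEH _)
      · have h := hEJ _ (J.vert_mem_zpow_image.1 hx')
        rw [neg_mul] at h
        rw [show i = q + -(C * J.shift) by omega]
      · exact absurd hij (hIJ j i)
      · have h := hYJ _ (J.vert_mem_zpow_image.1 hx')
        have := hi.1
        rw [neg_mul] at h
        omega
      · exact absurd hij.symm (hJH i j))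
    refine (g1234.append g5 ?_).mem_sawLanguage
    simp only [Set.image_union, I.zpow_image_Icc, H.zpow_image_Icc, neg_mul]
    have hZI : ∀ i, I.vert i ∈ (τ ^ ((N : ℤ) + C)) '' Z → p + N * I.shift < i := by
      intro i hi
      have h := (hB _ (I.vert_mem_zpow_image.1 hi)).1
      rw [add_mul] at h
      omega
    have hZJ : ∀ i, J.vert i ∈ (τ ^ ((N : ℤ) + C)) '' Z → q + N * J.shift < i := by
      intro i hi
      have h := (hB' _ (J.vert_mem_zpow_image.1 hi)).1
      rw [add_mul] at h
      omega
    rintro _ ((((hx | ⟨i, hi, rfl⟩) | hx) | ⟨i, hi, rfl⟩) |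
        (((hx | ⟨i, hi, rfl⟩) | hx) | ⟨i, hi, rfl⟩)) hx'
    · obtain ⟨x, hx', rfl⟩ := hx'
      exact absurd rfl (hD₀ (N + C) (by omega) x (by simp [hx']) _ (Or.inl (Or.inl (Or.inl hx))))
    · have := hZI i hx'
      have := hi.2
      omega
    · obtain ⟨x, hx, rfl⟩ := hx
      obtain ⟨x', hx', h⟩ := hx'
      exact absurd h.symm (hD' N (N + C) (by omega) x (by simp [hx]) x' (by simp [hx']))
    · have := hZJ i hx'
      have := hi.2
      omega
    · obtain ⟨x, hx, rfl⟩ := hx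
      obtain ⟨x', hx', h⟩ := hx'
      exact absurd h.symm (hD' (-C) (N + C) (by omega) x (by simp [hx]) x' (by simp [hx']))
    · have := hZI i hx'
      have := hi.2
      omega
    · obtain ⟨x, hx, rfl⟩ := hx
      obtain ⟨x', hx', h⟩ := hx'
      exact absurd h.symm (hD' (-C) (N + C) (by omega) x (by simp [hx]) x' (by simp [hx']))
    · have h := hZH _ (H.vert_mem_zpow_image.1 hx')
      have h' := hi.2
      push_cast at h'
      congr 1
      linarith
  · intro k l m hl hkl
    -- The vertex where the walk crosses back to `I` was already passed on the way out.
    have := not_mem_sawLanguage hdet ((h1 k).spells.append (h2 k).spells)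
      (((h3 k l).spells.append (h4 k l m).spells).append (h5 k l m).spells)
      (z := I.vert (p + (k - l : ℤ) * I.shift)) ?_ ?_ (hIJ _ _)
    · simpa only [List.append_assoc] using this
    · refine Or.inl (Or.inr ⟨_, ⟨?_, ?_⟩, rfl⟩)
      · have : 0 ≤ (k - l : ℤ) * I.shift := mul_nonneg (by omega) hI.le
        omega
      · have : 0 ≤ (l : ℤ) * I.shift := by positivity
        rw [sub_mul]
        omega
    · refine Or.inl (Or.inr (I.vert_mem_zpow_image.2 (Or.inl (Or.inl (Or.inr ⟨p, ?_, ?_⟩)))))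
      · exact ⟨hyp, le_rfl⟩
      · congr 1
        ring
  · intro k l m hm hml
    -- The final vertex lies on the stretch of `J` already used.
    have := not_mem_sawLanguage hdet
      ((((h1 k).spells.append (h2 k).spells).append (h3 k l).spells).append (h4 k l m).spells)
      (h5 k l m).spells (z := J.vert (z' + (k - l + m : ℤ) * J.shift)) ?_ (h5 k l m).spells.right_mem
      (hJH _ _)
    · simpa only [List.append_assoc] using this
    · refine Or.inl (Or.inr ⟨_, ⟨?_, ?_⟩, rfl⟩)
      · have := J.le_mul_shift m
        rw [add_mul]
        omega
      · have h : ((m + C : ℕ) : ℤ) * J.shift ≤ l * J.shift :=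
          mul_le_mul_of_nonneg_right (by exact_mod_cast hml) hJ.le
        have := J.le_mul_shift C
        rw [Nat.cast_add, add_mul] at h
        rw [add_mul, sub_mul]
        omega

end Lane

/-! ### Choosing the roles of the lanes and their links -/

section Lanes

variable {V A : Type*} {X : SimpleGraph V} {τ : X ≃g X} {ℓ : X.Dart → A}

theorem not_isContextFree_of_lanes (hconn : X.Connected) (hdet : IsDeterministic X ℓ)
    (hτ : τ ∈ labelAut X ℓ) (R : Fin 3 → Lane X τ)
    (hR : ∀ i j, i ≠ j → ∀ s t, (R i).vert s ≠ (R j).vert t) (o : V) :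
    ¬ (sawLanguage X ℓ o).IsContextFree := by
  have hz : ∀ n : ℤ, τ ^ n ∈ labelAut X ℓ := fun n => (labelAut X ℓ).zpow_mem hτ n
  -- A shortest path from `o` to the union of the lanes decides which lane is `I`; it meets the
  -- union only at its end.
  obtain ⟨_, rfl, _, ⟨⟨i, s⟩, rfl⟩, wP, P, hP, hP'⟩ :=
    exists_spellsPath_direct ℓ hconn (P := {o}) (Q := Set.range fun x : Fin 3 × ℤ => (R x.1).vert x.2)
      ⟨o, rfl⟩ ⟨_, (0, 0), rfl⟩
  simp only at hP hP'
  obtain ⟨j₀, hj₀⟩ := exists_ne i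
  -- `J` is a nearest other lane, so the link misses the third one.
  obtain ⟨_, ⟨p₀, rfl⟩, _, ⟨j, q₀, hji, rfl⟩, wE, E₀, hE₀, hE₀'⟩ :=
    exists_spellsPath_direct ℓ hconn (P := Set.range (R i).vert)
      (Q := {x | ∃ j t, j ≠ i ∧ (R j).vert t = x}) ⟨_, 0, rfl⟩ ⟨_, j₀, 0, hj₀, rfl⟩
  obtain ⟨h, hhi, hhj⟩ : ∃ h : Fin 3, h ≠ i ∧ h ≠ j := by
    clear * -
    revert i j
    decide
  have hI := (R i).shift_pos
  have hJ := (R j).shift_pos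
  have hH := (R h).shift_pos
  -- the link from `I` to `J`, moved to the right of the path from `o`
  obtain ⟨p, q, E, hsp, hE, hEI, hEJ, hEH⟩ : ∃ p q E, s ≤ p ∧
      SpellsPath ℓ ((R i).vert p) wE ((R j).vert q) E ∧ (∀ t, (R i).vert t ∈ E → t = p) ∧
      (∀ t, (R j).vert t ∈ E → t = q) ∧ ∀ t, (R h).vert t ∉ E := by
    set n : ℕ := (s - p₀).natAbs with hn
    have := (R i).le_mul_shift n
    have h1 := hE₀.map (hz n)
    rw [(R i).zpow_apply, (R j).zpow_apply] at h1
    refine ⟨_, _, _, ?_, h1, fun t ht => ?_, fun t ht => ?_, fun t ht => ?_⟩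
    · omega
    · have := (R i).inj ((hE₀' _ ((R i).vert_mem_zpow_image.1 ht)).1 ⟨_, rfl⟩)
      omega
    · have := (R j).inj ((hE₀' _ ((R j).vert_mem_zpow_image.1 ht)).2 ⟨j, _, hji, rfl⟩)
      omega
    · exact hR h j hhj _ _ ((hE₀' _ ((R h).vert_mem_zpow_image.1 ht)).2 ⟨h, _, hhi, rfl⟩)
  -- a path from `I` to `H`, moved far to the left
  obtain ⟨y, y', wY, Y, hY, hYI, hYJ, hYH, hyp, hYE⟩ : ∃ y y' wY Y,
      SpellsPath ℓ ((R i).vert y) wY ((R h).vert y') Y ∧ (∀ t, (R i).vert t ∈ Y → t ≤ y) ∧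
      (∀ t, (R j).vert t ∈ Y → t < q) ∧ (∀ t, (R h).vert t ∈ Y → t ≤ y') ∧ y ≤ p ∧
      ∀ x ∈ E, x ∉ Y := by
    obtain ⟨y, y', w, Y, hY, hYI, hYH⟩ := exists_spellsPath_max ℓ hconn (R i).inj (R h).inj
    obtain ⟨D, hD⟩ := (R i).exists_disjoint_translates hconn hdet hτ
      (hE.spells.finite.union hY.spells.finite)
    obtain ⟨B, hB⟩ := (R j).exists_index_bound hY.spells.finite
    set n : ℕ := D + B + y.natAbs + p.natAbs + q.natAbs + 1 with hn
    have hnI := (R i).le_mul_shift n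
    have hnJ := (R j).le_mul_shift n
    have h1 := hY.map (hz (-n))
    rw [(R i).zpow_apply, (R h).zpow_apply] at h1
    simp only [neg_mul] at h1
    refine ⟨_, _, _, _, h1, fun t ht => ?_, fun t ht => ?_, fun t ht => ?_, by omega, ?_⟩
    · have := hYI _ ((R i).vert_mem_zpow_image.1 ht)
      rw [neg_mul] at this
      omega
    · have := (hB _ ((R j).vert_mem_zpow_image.1 ht)).2
      rw [neg_mul] at this
      omega
    · have := hYH _ ((R h).vert_mem_zpow_image.1 ht)
      rw [neg_mul] at this
      omega
    · rintro x hx ⟨x', hx', hxx⟩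
      exact hD (-n) 0 (by omega) x' (Or.inr hx') x (Or.inl hx) hxx
  -- a path from `H` to `J`, moved to the right
  obtain ⟨z, z', wZ, Z, hZ, hZH, hyz⟩ : ∃ z z' wZ Z,
      SpellsPath ℓ ((R h).vert z) wZ ((R j).vert z') Z ∧ (∀ t, (R h).vert t ∈ Z → z ≤ t) ∧
      y' ≤ z := by
    -- Reversing `H` turns the largest index on the path into the smallest.
    obtain ⟨z, z', w, Z, hZ, hZH, -⟩ :=
      exists_spellsPath_max ℓ hconn (R h).reverse.inj (R j).inj
    set n : ℕ := (y' + z).natAbs with hn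
    have hnH := (R h).le_mul_shift n
    have e : ∀ t, (R h).reverse.vert t = (R h).vert (-t) := fun _ => rfl
    rw [e] at hZ
    have h1 := hZ.map (hz n)
    rw [(R h).zpow_apply, (R j).zpow_apply] at h1
    refine ⟨_, _, _, _, h1, fun t ht => ?_, by omega⟩
    have := hZH (-(t - n * (R h).shift)) (by
      rw [e, neg_neg]
      exact (R h).vert_mem_zpow_image.1 ht)
    omega
  have hPt : ∀ k t, (R k).vert t ∈ P → (R k).vert t = (R i).vert s := fun k t ht =>
    (hP' _ ht).2 ⟨(k, t), rfl⟩
  exact not_isContextFree_of_linked_lanes hconn hdet hτ (R i) (R j) (R h) (hR i j hji.symm)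
    (hR i h hhi.symm) (hR j h hhj.symm) hP (fun t ht => (R i).inj (hPt i t ht))
    (fun t ht => hR j i hji _ _ (hPt j t ht)) (fun t ht => hR h i hhi _ _ (hPt h t ht)) hsp hE hEI
    hEJ hEH hY hYI hYJ hYH hyp hYE hZ hZH hyz

end Lanes

/-! ### From strips to lanes -/

section Strips

variable {V : Type*}

/-- An injective sequence with steps `±1` cannot turn back, so all its steps agree. -/
theorem eq_add_or_eq_sub_of_injective {f : ℤ → ℤ} (hf : Function.Injective f)
    (h : ∀ t, f (t + 1) = f t + 1 ∨ f (t + 1) = f t - 1) :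
    (∀ t, f t = f 0 + t) ∨ ∀ t, f t = f 0 - t := by
  have key : ∀ t, f (t + 1 + 1) - f (t + 1) = f (t + 1) - f t := fun t => by
    have h1 : f (t + 1 + 1) ≠ f t := fun h => by
      have := hf h
      omega
    have h2 := h t
    have h3 := h (t + 1)
    omega
  have key' : ∀ t, f (t + 1) - f t = f 1 - f 0 := fun t => by
    induction t with
    | zero => simp
    | succ n ih => rw [key, ih]
    | pred n ih =>
      have := key (-n - 1)
      rw [sub_add_cancel] at this
      rw [sub_add_cancel, ← this, ih]
  have key'' : ∀ t, f t = f 0 + t * (f 1 - f 0) := fun t => by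
    induction t with
    | zero => simp
    | succ n ih =>
      have := key' n
      linarith
    | pred n ih =>
      have := key' (-n - 1)
      rw [sub_add_cancel] at this
      linarith
  have h0 := h 0
  rw [zero_add] at h0
  rcases h0 with h0 | h0
  · refine Or.inl fun t => ?_
    rw [key'' t, h0]
    ring
  · refine Or.inr fun t => ?_
    rw [key'' t, h0]
    ring

theorem disjoint_endComponent {G : SimpleGraph V} {K : Set V} {ω : EndSpace G} {v : V}
    (h : v ∈ endComponent G K ω) : v ∉ K := by
  obtain ⟨C, -, ⟨hv, -⟩⟩ := h
  exact hv

/-- The components of a defining sequence are nested, so every later translate of `K` lies in `C(K,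
ω)`, which avoids `K`. -/
theorem pow_apply_ne_of_isDefiningSequence {G : SimpleGraph V} {σ : G ≃g G} {K : Set V}
    {ω : EndSpace G} (h : IsDefiningSequence G (fun n : ℕ => (σ ^ n) '' K) ω) {v : V} (hv : v ∈ K)
    (n : ℕ) : (σ ^ (n + 1)) v ≠ v := by
  have h1 : ∀ n : ℕ, endComponent G ((σ ^ n) '' K) ω ⊆ endComponent G K ω := by
    intro n
    induction n with
    | zero => simp
    | succ n ih => exact (Set.subset_union_right.trans (h.2 n)).trans ih
  have h2 := disjoint_endComponent (h1 n (h.2 n (Or.inl ⟨v, hv, rfl⟩)))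
  intro h3
  rw [h3] at h2
  exact h2 hv

/-- The double rays of a strip are lanes. -/
theorem exists_lane_of_isDoubleRay {X : SimpleGraph V} {τ : X ≃g X} {S : X.Subgraph}
    {σ : S.coe ≃g S.coe} (hσ : ∀ v : S.verts, (σ v : V) = τ v) {R : S.coe.Subgraph}
    (hR : IsDoubleRay R) (hmap : R.map σ.toHom = R) {v : S.verts} (hv : v ∈ R.verts)
    (hper : ∀ n : ℕ, (σ ^ (n + 1)) v ≠ v) :
    ∃ L : Lane X τ, ∀ t, ∃ x ∈ R.verts, L.vert t = x := by
  obtain ⟨ρ, hρ, hverts, hadj⟩ := hR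
  -- The map `f` that `σ` induces on indices preserves adjacency, so it is a translation or a
  -- reflection.
  have h1 : ∀ t, ∃ u, ρ u = σ (ρ t) := fun t => by
    have : σ (ρ t) ∈ R.verts := by
      rw [← hmap]
      exact ⟨ρ t, hverts ▸ ⟨t, rfl⟩, rfl⟩
    rwa [hverts] at this
  choose f hf using h1
  have hfinj : Function.Injective f := fun s t hst => by
    apply hρ
    apply σ.injective
    rw [← hf, ← hf, hst]
  have hstep : ∀ t, f (t + 1) = f t + 1 ∨ f (t + 1) = f t - 1 := fun t => by
    have h2 : R.Adj (ρ (f t)) (ρ (f (t + 1))) := by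
      rw [hf, hf, ← hmap]
      exact ⟨ρ t, ρ (t + 1), (hadj _ _).2 ⟨t, rfl⟩, rfl, rfl⟩
    obtain ⟨i, hi⟩ := (hadj _ _).1 h2
    rcases Sym2.eq_iff.1 hi with ⟨h3, h4⟩ | ⟨h3, h4⟩
    · have := hρ h3
      have := hρ h4
      omega
    · have := hρ h3
      have := hρ h4
      omega
  have hXadj : ∀ t, X.Adj (ρ t) (ρ (t + 1)) := fun t =>
    ((hadj (ρ t) (ρ (t + 1))).2 ⟨t, rfl⟩).adj_sub.adj_sub
  have hinj : Function.Injective fun t => (ρ t : V) := Subtype.val_injective.comp hρ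
  rw [hverts] at hv
  obtain ⟨t₀, rfl⟩ := hv
  rcases eq_add_or_eq_sub_of_injective hfinj hstep with h | h
  · have hτ : ∀ t, τ (ρ t) = ρ (t + f 0) := fun t => by
      rw [← hσ, ← hf, h t, add_comm]
    rcases lt_trichotomy (f 0) 0 with h0 | h0 | h0
    -- A negative translation becomes positive when the ray is traversed backwards.
    · refine ⟨⟨fun t => ρ (-t), hinj.comp neg_injective, fun t => ?_, -f 0, by omega, fun t => ?_⟩,
        fun t => ⟨ρ (-t), hverts ▸ ⟨-t, rfl⟩, rfl⟩⟩
      · have := (hXadj (-(t + 1))).symm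
        rwa [show -(t + 1) + 1 = -t by ring] at this
      · rw [hτ, show -(t + -f 0) = -t + f 0 by ring]
    · refine absurd ?_ (hper 0)
      rw [zero_add, pow_one, ← hf, h t₀, h0, zero_add]
    · exact ⟨⟨fun t => ρ t, hinj, hXadj, f 0, h0, hτ⟩, fun t => ⟨ρ t, hverts ▸ ⟨t, rfl⟩, rfl⟩⟩
  -- A reflection is an involution, but `σ ^ 2` moves `v`.
  · refine absurd ?_ (hper 1)
    rw [pow_succ, pow_one, RelIso.mul_apply, ← hf, ← hf, h (f t₀), h t₀]
    congr 1
    ring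

theorem ContainsTauStrip.exists_lanes {X : SimpleGraph V} {τ : X ≃g X} {m : ℕ}
    (h : ContainsTauStrip X τ m) : ∃ L : Fin m → Lane X τ,
      ∀ i j, i ≠ j → ∀ s t, (L i).vert s ≠ (L j).vert t := by
  obtain ⟨S, σ, hσ, -, ωp, ωm, -, K, -, hdef, -, ⟨R, hray, hdisj, hmap, hmeet⟩, -⟩ := h
  have key : ∀ i, ∃ L : Lane X τ, ∀ t, ∃ x ∈ (R i).verts, L.vert t = x := fun i => by
    obtain ⟨v, ⟨hv, hvK⟩, -⟩ := hmeet i 0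
    rw [zpow_zero] at hvK
    obtain ⟨v, hvK, rfl⟩ := hvK
    exact exists_lane_of_isDoubleRay hσ (hray i) (hmap i) hv
      fun n => pow_apply_ne_of_isDefiningSequence hdef hvK n
  choose L hL using key
  refine ⟨L, fun i j hij s t hst => ?_⟩
  obtain ⟨x, hx, hx'⟩ := hL i s
  obtain ⟨y, hy, hy'⟩ := hL j t
  obtain rfl : x = y := Subtype.val_injective (by rw [← hx', hst, hy'])
  exact Set.disjoint_left.1 (hdisj i j hij) hx hy

end Strips

end SAWLang

theorem proposition4p6 {V A : Type*} [Infinite V] [Finite A] (X : SimpleGraph V)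
    (hconn : X.Connected) (ℓ : X.Dart → A) (hdet : SAWLang.IsDeterministic X ℓ)
    (hqt : SAWLang.ActsQuasiTransitively X (SAWLang.labelAut X ℓ))
    (τ : X ≃g X) (hτ : τ ∈ SAWLang.labelAut X ℓ)
    (hstrip : SAWLang.ContainsTauStrip X τ 3) (o : V) :
    ¬ (SAWLang.sawLanguage X ℓ o).IsContextFree := by
  obtain ⟨L, hL⟩ := hstrip.exists_lanes
  exact SAWLang.not_isContextFree_of_lanes hconn hdet hτ L hL o
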